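/- Let $p\ge 1$ and $r\ge 1$ be integers and let $H$ be a fixed finite graph with chromatic number $p+1$. For a graph $F$, let $bs^{(r)}(F)$ denote the largest $q$ such that $F$ contains the book $B_q^{(r)}=K_r+qK_1$ ($q$ vertices, the pages, each joined to all vertices of a common $r$-clique) as a not necessarily induced subgraph, with $bs^{(r)}(F)=0$ if $F$ has no $r$-clique. Then $$bs^{(r)}(\overline G)>\Bigl(\frac1p+o(1)\Bigr)n$$ for every graph $G$ of order $n\ge 1$ that does not contain $H$ as a (not necessarily induced) subgraph, where $o(1)$ denotes a function of $n$, depending only on $H$ and $r$, that tends to $0$ as $n\to\infty$. -/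

import Mathlib

/-- The `r`-book `K_r + q K_1` with `q` pages: the vertices `Sum.inl i` form the base, an
`r`-clique; the vertices `Sum.inr j` are the pages, pairwise nonadjacent, each joined to every
vertex of the base. -/
def bookGraph (r q : ℕ) : SimpleGraph (Fin r ⊕ Fin q) where
  Adj
    | Sum.inl i, Sum.inl j => i ≠ j
    | Sum.inl _, Sum.inr _ => True
    | Sum.inr _, Sum.inl _ => True
    | Sum.inr _, Sum.inr _ => False
  symm := ⟨by
    rintro (i | i) (j | j) h
    · exact Ne.symm h
    · trivial
    · trivial
    · exact h⟩
  loopless := ⟨by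
    rintro (i | i) h
    · exact h rfl
    · exact h⟩

/-- `bs^(r)(G)`: the number of pages of the largest `r`-book contained in `G` as a (not
necessarily induced) subgraph. For a finite graph the set below is bounded when nonempty;
it is empty, and the value is `0`, exactly when `G` has no `r`-clique. -/
noncomputable def bookSize {V : Type*} (r : ℕ) (G : SimpleGraph V) : ℕ :=
  sSup {q : ℕ | (bookGraph r q).IsContained G}

/-! The Erdős–Stone induction is run on complete `q`-partite families in `G` with large parts. It
cannot reach `q = p + 1`, because such a family with parts of size `|H|` contains `H`. Where it
fails, with `q ≤ p` parts, all but boundedly many vertices have fewer than `t` neighbours in some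
part; otherwise `IsCompletePartiteFamily.exists_succ` would add a part. Hence one part `A i` is
sparsely joined to a set `S` of about `n / p` or more vertices.

Double counting leaves many vertices of `A i` with at most `δ * #S` neighbours in `S`. A clique on
`|H|` vertices would contain `H`, so Ramsey's theorem finds `r` independent vertices among them. In
the complement these form the base, and almost all of `S` serves as pages. -/

/-- A finite form of Ramsey's theorem: a large set of vertices contains an `a`-clique or a set of
`b` pairwise nonadjacent vertices. -/
theorem exists_isNClique_or_compl_of_le_card (a b : ℕ) :
    ∃ N : ℕ, ∀ {V : Type} (G : SimpleGraph V) (s : Finset V), N ≤ s.card →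
      (∃ c ⊆ s, G.IsNClique a c) ∨ ∃ c ⊆ s, Gᶜ.IsNClique b c := by
  classical
  induction a generalizing b with
  | zero => exact ⟨0, fun G s _ => .inl ⟨∅, by simp, by simp [SimpleGraph.isNClique_iff]⟩⟩
  | succ a iha =>
    induction b with
    | zero => exact ⟨0, fun G s _ => .inr ⟨∅, by simp, by simp [SimpleGraph.isNClique_iff]⟩⟩
    | succ b ihb =>
      obtain ⟨N₁, h₁⟩ := iha (b + 1)
      obtain ⟨N₂, h₂⟩ := ihb
      refine ⟨N₁ + N₂ + 1, fun {V} G s hs => ?_⟩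
      obtain ⟨v, hv⟩ : s.Nonempty := Finset.card_pos.mp (by omega)
      have hcard := Finset.card_filter_add_card_filter_not (s := s.erase v) (fun w => G.Adj v w)
      rw [Finset.card_erase_of_mem hv] at hcard
      have hsub : ∀ q : V → Prop, ∀ [DecidablePred q], (s.erase v).filter q ⊆ s := fun q _ =>
        (Finset.filter_subset _ _).trans (Finset.erase_subset _ _)
      by_cases hN : N₁ ≤ ((s.erase v).filter (fun w => G.Adj v w)).card
      · obtain ⟨c, hc, hcl⟩ | ⟨c, hc, hcl⟩ := h₁ G _ hN
        · refine .inl ⟨insert v c, Finset.insert_subset hv (hc.trans (hsub _)), hcl.insert ?_⟩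
          exact fun w hw => (Finset.mem_filter.mp (hc hw)).2
        · exact .inr ⟨c, hc.trans (hsub _), hcl⟩
      · obtain ⟨c, hc, hcl⟩ | ⟨c, hc, hcl⟩ :=
          h₂ G ((s.erase v).filter (fun w => ¬ G.Adj v w)) (by omega)
        · exact .inl ⟨c, hc.trans (hsub _), hcl⟩
        · refine .inr ⟨insert v c, Finset.insert_subset hv (hc.trans (hsub _)), hcl.insert ?_⟩
          intro w hw
          have hw' := Finset.mem_filter.mp (hc hw)
          exact (SimpleGraph.compl_adj _ _ _).mpr ⟨(Finset.ne_of_mem_erase hw'.1).symm, hw'.2⟩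

/-- `A` is a family of vertex sets of size `t`, any two of which are completely joined in `G`. -/
structure IsCompletePartiteFamily {V ι : Type*} (G : SimpleGraph V) (t : ℕ)
    (A : ι → Finset V) : Prop where
  card_eq : ∀ i, (A i).card = t
  adj : ∀ i j, i ≠ j → ∀ v ∈ A i, ∀ w ∈ A j, G.Adj v w

/-- A graph containing a complete multipartite family with large enough parts contains every
small graph that can be coloured by the parts. -/
theorem IsCompletePartiteFamily.isContained {V ι W : Type*} [Fintype W] {G : SimpleGraph V}
    {A : ι → Finset V} (hA : IsCompletePartiteFamily G (Fintype.card W) A)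
    {H : SimpleGraph W} (C : H.Coloring ι) : H.IsContained G := by
  classical
  let e : ∀ i, W ≃ A i := fun i => Fintype.equivOfCardEq (by simp [hA.card_eq])
  refine ⟨⟨⟨fun w => (e (C w) w : V), ?_⟩, ?_⟩⟩
  · intro v w hvw
    exact hA.adj _ _ (C.valid hvw) _ (e _ v).2 _ (e _ w).2
  · intro v w hvw
    change (e (C v) v : V) = e (C w) w at hvw
    -- Within a colour class the map is a bijection onto a part; distinct parts are disjoint because
    -- completely joined.
    by_cases h : C v = C w
    · rw [h] at hvw
      exact (e (C w)).injective (Subtype.ext hvw)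
    · have := hA.adj _ _ h _ (e _ v).2 _ (e _ w).2
      exact absurd hvw this.ne

/-- A clique contains every graph on as many vertices. -/
theorem isContained_of_isNClique {V W : Type*} [Fintype W] {G : SimpleGraph V} {c : Finset V}
    (hc : G.IsNClique (Fintype.card W) c) (H : SimpleGraph W) : H.IsContained G := by
  classical
  let e : W ≃ c := Fintype.equivOfCardEq (by simp [hc.card_eq])
  refine ⟨⟨⟨fun w => (e w : V), ?_⟩, ?_⟩⟩
  · intro v w hvw
    exact hc.isClique (e v).2 (e w).2 fun h => hvw.ne (e.injective (Subtype.ext h))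
  · intro v w hvw
    exact e.injective (Subtype.ext hvw)

/-- If many vertices have at least `t` neighbours in every part of a complete `q`-partite family,
then there is a complete `(q + 1)`-partite family with parts of size `t`. -/
theorem IsCompletePartiteFamily.exists_succ {V : Type*} [DecidableEq V] {G : SimpleGraph V}
    [DecidableRel G.Adj] {q T t : ℕ} {A : Fin q → Finset V} (hA : IsCompletePartiteFamily G T A)
    {F : Finset V} (hF : ∀ v ∈ F, ∀ i, t ≤ ((A i).filter (G.Adj v)).card)
    (hcard : (2 ^ T) ^ q * t ≤ F.card) :
    ∃ B : Fin (q + 1) → Finset V, IsCompletePartiteFamily G t B := by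
  choose! g hgsub hgcard using fun v (hv : v ∈ F) i => Finset.exists_subset_card_eq (hF v hv i)
  -- Pigeonhole over tuples of subsets of the parts: some `t` vertices of `F` choose the same tuple,
  -- and they become the new part.
  let Y : Finset (Fin q → Finset V) := Fintype.piFinset fun i => (A i).powerset
  have hYcard : Y.card = (2 ^ T) ^ q := by
    simp [Y, Fintype.card_piFinset, Finset.card_powerset, hA.card_eq]
  have hgY : ∀ v ∈ F, g v ∈ Y := fun v hv => Fintype.mem_piFinset.mpr fun i =>
    Finset.mem_powerset.mpr ((hgsub v hv i).trans (Finset.filter_subset _ _))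
  have hY : Y.Nonempty := ⟨fun _ => ∅, Fintype.mem_piFinset.mpr fun i => by simp⟩
  obtain ⟨y, hy, hyt⟩ := Finset.exists_le_card_fiber_of_mul_le_card_of_maps_to hgY hY
    (by rw [hYcard]; exact hcard)
  obtain ⟨B₀, hB₀, hB₀card⟩ := Finset.exists_subset_card_eq hyt
  have hB₀F : ∀ v ∈ B₀, v ∈ F ∧ g v = y := fun v hv => Finset.mem_filter.mp (hB₀ hv)
  rcases Nat.eq_zero_or_pos t with rfl | ht
  · exact ⟨fun _ => ∅, fun _ => rfl, fun _ _ _ v hv => by simp at hv⟩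
  obtain ⟨v₀, hv₀⟩ : B₀.Nonempty := Finset.card_pos.mp (by omega)
  have hycard : ∀ i, (y i).card = t := fun i => by
    rw [← (hB₀F v₀ hv₀).2]; exact hgcard _ (hB₀F v₀ hv₀).1 i
  have hysub : ∀ i, y i ⊆ A i := fun i => Finset.mem_powerset.mp (Fintype.mem_piFinset.mp hy i)
  have hadj : ∀ i, ∀ v ∈ B₀, ∀ w ∈ y i, G.Adj v w := fun i v hv w hw => by
    obtain ⟨hvF, hvy⟩ := hB₀F v hv
    rw [← hvy] at hw
    exact (Finset.mem_filter.mp (hgsub v hvF i hw)).2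
  refine ⟨Fin.cons B₀ y, ⟨fun i => ?_, fun i j hij v hv w hw => ?_⟩⟩
  · cases i using Fin.cases with
    | zero => exact hB₀card
    | succ i => exact hycard i
  · cases i using Fin.cases with
    | zero =>
      cases j using Fin.cases with
      | zero => exact absurd rfl hij
      | succ j => exact hadj j v hv w hw
    | succ i =>
      cases j using Fin.cases with
      | zero => exact (hadj i w hw v hv).symm
      | succ j =>
        exact hA.adj i j (fun h => hij (by rw [h])) v (hysub i hv) w (hysub j hw)

/-- If every vertex of `S` has at most `t` neighbours in `A`, then at most `t / δ` vertices of `A`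
have more than `δ * #S` neighbours in `S`. -/
theorem card_filter_lt_card_adj_le {V : Type*} {G : SimpleGraph V} [DecidableRel G.Adj]
    {A S : Finset V} {t : ℕ} {δ : ℝ} (hδ : 0 < δ)
    (hS : ∀ v ∈ S, (A.filter (G.Adj v)).card ≤ t) :
    ((A.filter fun a => δ * S.card < (S.filter (G.Adj a)).card).card : ℝ) ≤ t / δ := by
  set B := A.filter fun a => δ * S.card < (S.filter (G.Adj a)).card with hB
  rcases S.eq_empty_or_nonempty with rfl | hne
  · simp [hB]; positivity
  have hSpos : (0 : ℝ) < S.card := by exact_mod_cast hne.card_pos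
  have h₁ : (B.card : ℝ) * (δ * S.card) ≤ ∑ a ∈ B, ((S.filter (G.Adj a)).card : ℝ) := by
    rw [← nsmul_eq_mul]
    exact Finset.card_nsmul_le_sum _ _ _ fun a ha => (Finset.mem_filter.mp ha).2.le
  have h₂ : ∑ a ∈ B, (S.filter (G.Adj a)).card ≤ S.card * t :=
    calc ∑ a ∈ B, (S.filter (G.Adj a)).card
      _ = ∑ v ∈ S, (B.filter fun a => G.Adj a v).card :=
        Finset.sum_card_bipartiteAbove_eq_sum_card_bipartiteBelow G.Adj
      _ ≤ ∑ v ∈ S, t := Finset.sum_le_sum fun v hv => by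
        refine le_trans (Finset.card_le_card fun a ha => ?_) (hS v hv)
        rw [Finset.mem_filter] at ha ⊢
        exact ⟨(Finset.mem_filter.mp ha.1).1, ha.2.symm⟩
      _ = S.card * t := by simp
  have h₃ : (B.card : ℝ) * (δ * S.card) ≤ S.card * t := h₁.trans (by exact_mod_cast h₂)
  rw [le_div_iff₀ hδ]
  nlinarith

/-- Pages for a base `R` each of whose vertices has few neighbours in `S`. -/
theorem exists_pages_of_card_adj_le {V : Type*} [DecidableEq V] {G : SimpleGraph V}
    [DecidableRel G.Adj] {R S : Finset V} {d : ℝ}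
    (hR : ∀ a ∈ R, ((S.filter (G.Adj a)).card : ℝ) ≤ d) :
    ∃ P : Finset V, (∀ v ∈ P, ∀ a ∈ R, Gᶜ.Adj a v) ∧
      (S.card : ℝ) - R.card * d - R.card ≤ P.card := by
  refine ⟨S.filter fun v => ∀ a ∈ R, Gᶜ.Adj a v, fun v hv => (Finset.mem_filter.mp hv).2, ?_⟩
  have hsub : S ⊆ (S.filter fun v => ∀ a ∈ R, Gᶜ.Adj a v) ∪
      (R.biUnion (fun a => S.filter (G.Adj a)) ∪ R) := by
    intro v hv
    by_cases h : ∀ a ∈ R, Gᶜ.Adj a v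
    · exact Finset.mem_union_left _ (Finset.mem_filter.mpr ⟨hv, h⟩)
    · push Not at h
      obtain ⟨a, ha, hav⟩ := h
      apply Finset.mem_union_right
      by_cases hva : a = v
      · exact Finset.mem_union_right _ (hva ▸ ha)
      · refine Finset.mem_union_left _ (Finset.mem_biUnion.mpr ⟨a, ha, Finset.mem_filter.mpr
          ⟨hv, ?_⟩⟩)
        by_contra hn
        exact hav ((SimpleGraph.compl_adj _ _ _).mpr ⟨hva, hn⟩)
  have h₁ : (S.card : ℝ) ≤ (S.filter fun v => ∀ a ∈ R, Gᶜ.Adj a v).card +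
      ((R.biUnion fun a => S.filter (G.Adj a)).card + R.card) := by
    exact_mod_cast (Finset.card_le_card hsub).trans
      ((Finset.card_union_le _ _).trans (Nat.add_le_add_left (Finset.card_union_le _ _) _))
  have h₂ : ((R.biUnion fun a => S.filter (G.Adj a)).card : ℝ) ≤ R.card * d :=
    calc ((R.biUnion fun a => S.filter (G.Adj a)).card : ℝ)
      _ ≤ ∑ a ∈ R, ((S.filter (G.Adj a)).card : ℝ) := by exact_mod_cast Finset.card_biUnion_le
      _ ≤ R.card * d := by
        rw [← nsmul_eq_mul]
        exact Finset.sum_le_card_nsmul _ _ _ hR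
  linarith

/-- A large `K_h`-free graph has a complete `q`-partite family, or its complement has a large
book. -/
theorem exists_isCompletePartiteFamily_or_book (p r h : ℕ) (hp : 1 ≤ p) {ε : ℝ} (hε : 0 < ε)
    (q : ℕ) (hq : q ≤ p + 1) (t : ℕ) :
    ∃ N : ℕ, ∀ n ≥ N, ∀ G : SimpleGraph (Fin n), G.CliqueFree h →
      (∃ A : Fin q → Finset (Fin n), IsCompletePartiteFamily G t A) ∨
      ∃ R P : Finset (Fin n), Gᶜ.IsNClique r R ∧ (∀ v ∈ P, ∀ a ∈ R, Gᶜ.Adj a v) ∧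
        (1 / (p : ℝ) - ε) * n ≤ P.card := by
  classical
  induction q generalizing t with
  | zero => exact ⟨0, fun n _ G _ => .inl ⟨Fin.elim0, fun i => i.elim0, fun i => i.elim0⟩⟩
  | succ q ih =>
    have hp' : (0 : ℝ) < p := by exact_mod_cast hp
    obtain ⟨M, hM⟩ := exists_isNClique_or_compl_of_le_card h r
    obtain ⟨δ, hδ, hδr⟩ : ∃ δ : ℝ, 0 < δ ∧ r * δ ≤ min 1 (ε / 2) := by
      have hm : 0 < min 1 (ε / 2) := by positivity
      refine ⟨min 1 (ε / 2) / (r + 1), by positivity, ?_⟩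
      rw [mul_div_assoc', div_le_iff₀ (by positivity)]
      nlinarith
    have hδ1 : r * δ ≤ 1 := hδr.trans (min_le_left _ _)
    have hδε : r * δ ≤ ε / 2 := hδr.trans (min_le_right _ _)
    -- At most `t / δ` vertices of a part are discarded, which leaves `M` for Ramsey's theorem.
    set T := M + ⌈t / δ⌉₊ with hT
    obtain ⟨N₀, hN₀⟩ := ih (by omega) T
    set C := (2 ^ T) ^ q * t with hC
    -- The exceptional vertices and the base cost at most `C + r ≤ ε / 2 * n`; neighbours of the
    -- base cost the other `ε / 2 * n`. The bound `C + 1` also rules out `q = 0`.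
    refine ⟨max N₀ (max (C + 1) ⌈(C + r) / (ε / 2)⌉₊), fun n hn G hG => ?_⟩
    have hnN₀ : N₀ ≤ n := (le_max_left _ _).trans hn
    have hnC : C + 1 ≤ n := ((le_max_left _ _).trans (le_max_right _ _)).trans hn
    have hnε : (C + r : ℝ) ≤ ε / 2 * n := by
      have : ((C + r) / (ε / 2) : ℝ) ≤ n := (Nat.le_ceil _).trans
        (by exact_mod_cast ((le_max_right _ _).trans (le_max_right _ _)).trans hn)
      rwa [div_le_iff₀' (by positivity)] at this
    obtain ⟨A, hA⟩ | hbook := hN₀ n hnN₀ G hG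
    swap
    · exact .inr hbook
    let F : Finset (Fin n) := Finset.univ.filter fun v => ∀ i, t ≤ ((A i).filter (G.Adj v)).card
    rcases le_or_gt C F.card with hF | hF
    · exact .inl (hA.exists_succ (F := F) (fun v hv => (Finset.mem_filter.mp hv).2) hF)
    right
    let S : Fin q → Finset (Fin n) := fun i =>
      Finset.univ.filter fun v => ((A i).filter (G.Adj v)).card < t
    have hcover : n ≤ F.card + ∑ i, (S i).card := by
      have : (Finset.univ : Finset (Fin n)) ⊆ F ∪ Finset.univ.biUnion S := fun v _ => by
        by_cases hv : v ∈ F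
        · exact Finset.mem_union_left _ hv
        · simp only [F, Finset.mem_filter, Finset.mem_univ, true_and, not_forall, not_le] at hv
          obtain ⟨i, hi⟩ := hv
          exact Finset.mem_union_right _ (Finset.mem_biUnion.mpr ⟨i, Finset.mem_univ _,
            Finset.mem_filter.mpr ⟨Finset.mem_univ _, hi⟩⟩)
      calc n = (Finset.univ : Finset (Fin n)).card := by simp
        _ ≤ _ := (Finset.card_le_card this).trans ((Finset.card_union_le _ _).trans
          (Nat.add_le_add_left Finset.card_biUnion_le _))
    obtain ⟨i, hi⟩ : ∃ i, (n - C : ℝ) / p ≤ (S i).card := by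
      by_contra! hcon
      have hle : ∑ i, ((S i).card : ℝ) ≤ q * ((n - C : ℝ) / p) := by
        have := Finset.sum_le_card_nsmul Finset.univ (fun i => ((S i).card : ℝ)) _
          fun i _ => (hcon i).le
        simpa using this
      have hqp : (q : ℝ) * ((n - C : ℝ) / p) ≤ n - C := by
        have hqp : (q : ℝ) ≤ p := by exact_mod_cast (by omega : q ≤ p)
        have hnC' : (0 : ℝ) ≤ n - C := by
          have : ((C + 1 : ℕ) : ℝ) ≤ n := by exact_mod_cast hnC
          push_cast at this
          linarith
        rw [mul_div_assoc', div_le_iff₀ hp', mul_comm]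
        gcongr
      have h₁ : (n : ℝ) ≤ F.card + ∑ i, ((S i).card : ℝ) := by exact_mod_cast hcover
      have h₂ : (F.card : ℝ) < C := by exact_mod_cast hF
      linarith
    have hbad := card_filter_lt_card_adj_le (A := A i) (S := S i) (t := t) hδ
      fun v hv => (Finset.mem_filter.mp hv).2.le
    have hsplit := Finset.card_filter_add_card_filter_not (s := A i)
      (fun a => δ * (S i).card < ((S i).filter (G.Adj a)).card)
    rw [hA.card_eq] at hsplit
    have hbad' := (Nat.le_floor hbad).trans (Nat.floor_le_ceil _)
    obtain ⟨c, -, hc⟩ | ⟨R, hRsub, hR⟩ := hM G _ (show M ≤ ((A i).filter fun a =>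
      ¬ δ * (S i).card < ((S i).filter (G.Adj a)).card).card by omega)
    · exact absurd hc (hG c)
    obtain ⟨P, hP, hPcard⟩ := exists_pages_of_card_adj_le (d := δ * (S i).card)
      fun a ha => not_lt.mp (Finset.mem_filter.mp (hRsub ha)).2
    refine ⟨R, P, hR, hP, le_trans ?_ hPcard⟩
    rw [hR.card_eq]
    have hSn : ((S i).card : ℝ) ≤ n := by
      exact_mod_cast (Finset.card_le_univ (S i)).trans (Fintype.card_fin n).le
    have h₁ : (r : ℝ) * (δ * (S i).card) ≤ ε / 2 * n := by
      rw [← mul_assoc]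
      gcongr
    have h₂ : (1 / (p : ℝ)) * n - C ≤ (n - C : ℝ) / p := by
      rw [sub_div]
      have : (C : ℝ) / p ≤ C := div_le_self (by positivity) (by exact_mod_cast hp)
      linarith [one_div_mul_eq_div (p : ℝ) n]
    linarith

/-- A lower bound for the book size from a base and a set of pages. -/
theorem le_bookSize {V : Type*} [Fintype V] {G : SimpleGraph V} {r : ℕ} {R P : Finset V}
    (hR : G.IsNClique r R) (hP : ∀ v ∈ P, ∀ a ∈ R, G.Adj a v) : P.card ≤ bookSize r G := by
  classical
  refine le_csSup ⟨Fintype.card V, ?_⟩ ?_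
  · rintro q ⟨f⟩
    simpa using Fintype.card_le_of_injective (fun j : Fin q => f (Sum.inr j))
      (f.injective.comp Sum.inr_injective)
  · let e : Fin r ≃ R := (Fintype.equivFinOfCardEq (by simp [hR.card_eq])).symm
    let e' : Fin P.card ≃ P := (Fintype.equivFinOfCardEq (by simp)).symm
    refine ⟨⟨⟨Sum.elim (fun i => (e i : V)) (fun j => (e' j : V)), ?_⟩, ?_⟩⟩
    · rintro (i | i) (j | j) hij
      · exact hR.isClique (e i).2 (e j).2 fun h => hij (e.injective (Subtype.ext h))
      · exact hP _ (e' j).2 _ (e i).2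
      · exact (hP _ (e' i).2 _ (e j).2).symm
      · exact hij.elim
    · refine Function.Injective.sumElim (Subtype.val_injective.comp e.injective)
        (Subtype.val_injective.comp e'.injective) fun i j => ?_
      exact (hP _ (e' j).2 _ (e i).2).ne

/-- The asymptotic lower bound in `ε`-form. -/
theorem exists_forall_mul_le_bookSize_compl {W : Type*} [Finite W] (p r : ℕ) (hp : 1 ≤ p)
    (H : SimpleGraph W) (hH : H.Colorable (p + 1)) {ε : ℝ} (hε : 0 < ε) :
    ∃ N : ℕ, ∀ n ≥ N, ∀ G : SimpleGraph (Fin n), H.Free G →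
      (1 / (p : ℝ) - ε) * n ≤ bookSize r Gᶜ := by
  have := Fintype.ofFinite W
  obtain ⟨N, hN⟩ := exists_isCompletePartiteFamily_or_book p r (Fintype.card W) hp hε (p + 1)
    le_rfl (Fintype.card W)
  refine ⟨N, fun n hn G hG => ?_⟩
  obtain ⟨A, hA⟩ | ⟨R, P, hR, hP, hcard⟩ :=
    hN n hn G fun c hc => hG (isContained_of_isNClique hc H)
  · exact absurd (hA.isContained hH.some) hG
  · exact hcard.trans (by exact_mod_cast le_bookSize hR hP)

theorem mainTheorem4 {W : Type*} [Finite W] (p r : ℕ) (hp : 1 ≤ p) (hr : 1 ≤ r)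
    (H : SimpleGraph W) (hH : H.chromaticNumber = ((p + 1 : ℕ) : ℕ∞)) :
    ∃ f : ℕ → ℝ, Filter.Tendsto f Filter.atTop (nhds 0) ∧
      ∀ n : ℕ, 1 ≤ n → ∀ G : SimpleGraph (Fin n), H.Free G →
        ((bookSize r Gᶜ : ℕ) : ℝ) > (1 / (p : ℝ) + f n) * (n : ℝ) := by
  classical
  have hcol : H.Colorable (p + 1) := SimpleGraph.chromaticNumber_le_iff_colorable.mp hH.le
  -- The deficit below `1 / p`, capped at `0`; its minimum over the finitely many graphs of order
  -- `n` is the error term.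
  let d (n : ℕ) (G : SimpleGraph (Fin n)) : ℝ :=
    if H.Free G then min 0 ((bookSize r Gᶜ : ℝ) / n - 1 / p) else 0
  have hbdd (n : ℕ) : BddBelow (Set.range (d n)) := (Set.finite_range _).bddBelow
  have hd0 (n : ℕ) (G : SimpleGraph (Fin n)) : d n G ≤ 0 := by
    simp only [d]
    split_ifs
    exacts [min_le_left _ _, le_rfl]
  have hlim : Filter.Tendsto (fun n => ⨅ G, d n G) Filter.atTop (nhds 0) := by
    rw [Metric.tendsto_atTop]
    intro ε hε
    obtain ⟨N, hN⟩ := exists_forall_mul_le_bookSize_compl p r hp H hcol (half_pos hε)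
    refine ⟨max N 1, fun n hn => ?_⟩
    have hn0 : (0 : ℝ) < n := by exact_mod_cast (le_max_right _ _).trans hn
    have hlow : -(ε / 2) ≤ ⨅ G, d n G := le_ciInf fun G => by
      simp only [d]
      split_ifs with hG
      · refine le_min (by linarith) ?_
        have := (le_div_iff₀ hn0).mpr (hN n ((le_max_left _ _).trans hn) G hG)
        linarith
      · linarith
    have hup : ⨅ G, d n G ≤ 0 := (ciInf_le (hbdd n) ⊥).trans (hd0 n ⊥)
    rw [Real.dist_eq, sub_zero, abs_of_nonpos hup]
    linarith
  -- The extra `1 / (n + 1)` makes the inequality strict.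
  refine ⟨fun n => (⨅ G, d n G) - 1 / ((n : ℝ) + 1), ?_, fun n hn G hG => ?_⟩
  · simpa using hlim.sub tendsto_one_div_add_atTop_nhds_zero_nat
  · have hn0 : (0 : ℝ) < n := by exact_mod_cast hn
    have h₁ : ⨅ G, d n G ≤ (bookSize r Gᶜ : ℝ) / n - 1 / p := by
      refine (ciInf_le (hbdd n) G).trans ?_
      simp only [d, if_pos hG]
      exact min_le_right _ _
    have h₂ : (0 : ℝ) < 1 / ((n : ℝ) + 1) := by positivity
    rw [gt_iff_lt, ← lt_div_iff₀ hn0]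
    linarith
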